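/- **Setting.** Let $1\le m\le n$ and $k\ge 2$, and let $\Gamma^n\subset\mathbb R^{n+1}$ be a $C^k$-smooth oriented hypersurface: a connected set such that for every $M\in\Gamma^n$ there are $r>0$, a domain $\Theta\subset\mathbb R^n$ and a homeomorphism $X:\Theta\to\Gamma^n\cap B_r(M)$ of class $C^k$ with $\det(X_\theta^TX_\theta)\ne0$, together with a continuous unit normal field $\mathbf n^+$ on $\Gamma^n$. For a $C^2$ local parametrization $X(\theta)$ put $X_k=\partial X/\partial\theta^k$ and $g=X_\theta^TX_\theta$. Let $\tau$ be a $C^1$ matrix field with $\tau\tau^T=g^{-1}$, and define invariant derivatives by $F_{(j)}=\sum_k\tau^k_j\,\partial F/\partial\theta^k$. The *curvature matrix* at a point $M$ is $\mathcal K[\Gamma^n](M)=\big((X_{(i)(j)},\mathbf n^+)\big)_{i,j=1}^n$; it is symmetric, and it is determined up to orthogonal similarity. For a symmetric matrix $S$ let $T_p(S)$ be the sum of its principal minors of order $p$, with $T_0(S)=1$. The *$p$-curvature* of $\Gamma^n$ is $\mathbf k_p[\Gamma^n](M)=T_p(\mathcal K[\Gamma^n](M))$. A point $M\in\Gamma^n$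 is a *point of $m$-convexity* if $T_p(\mathcal K[\Gamma^n](M))>0$ for all $p=0,1,\dots,m$. For $1\le q\le n$, a *$q$-direction* at $M$ is a $q$-dimensional subspace of the tangent plane of $\Gamma^n$ at $M$, that is, the span $\mathcal L$ of $l_i=\sum_k X_{(k)}\eta^k_i$, $i=1,\dots,q$, for some $n\times q$ matrix $\eta$ with $\eta^T\eta=I$. The corresponding *normal $q$-section* of $\Gamma^n$ at $M$ is $\Gamma^q=\Gamma^n\cap\mathcal P$, where $\mathcal P$ is the $(q+1)$-dimensional plane through $M$ parallel to $\mathbf n^+(M)$ and $\mathcal L$. Near $M$ it is regarded as a hypersurface in $\mathcal P\cong\mathbb R^{q+1}$ with unit normal $\mathbf n^+(M)$ at $M$, and its curvature matrix and $p$-curvatures at $M$ are defined as above. **Corollary 5.16.** Suppose that $\mathbf k_m[\Gamma^n](M)>0$ at all points $M\in\Gamma^n$, and that there exist a point $M_0\in\Gamma^n$, an integer $p$ with $1\le p\le m-1$, and a normal $(n-p)$-section $\Gamma^{n-p}$ of $\Gamma^n$ at $M_0$ such that $$\mathbf k_{m-p}[\Gamma^{n-p}](M_0)=0 .$$ Then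 the hypersurface $\Gamma^n$ has no points of $m$-convexity. -/

import Mathlib

namespace SurfaceGeometry

/-! ### Algebra: traces of matrices and the cones of positive matrices -/

/-- The `p`-trace `T_p(S)`: the sum of all principal minors of order `p`; `T_0(S) = 1`. -/
noncomputable def pTrace {n : ℕ} (p : ℕ) (S : Matrix (Fin n) (Fin n) ℝ) : ℝ :=
  ∑ s ∈ (Finset.univ : Finset (Fin n)).powersetCard p,
    (S.submatrix (fun i : s => (i : Fin n)) (fun i : s => (i : Fin n))).det

/-- `S` is `m`-positive: `S` is symmetric and `T_p(S) > 0` for `p = 0, 1, …, m`. -/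
def IsMPositive {n : ℕ} (m : ℕ) (S : Matrix (Fin n) (Fin n) ℝ) : Prop :=
  S.IsSymm ∧ ∀ p ≤ m, 0 < pTrace p S

/-! ### Parametrized surfaces in a Euclidean space `V` -/

section Surfaces

variable {V : Type*} [NormedAddCommGroup V] [InnerProductSpace ℝ V] {q : ℕ}

/-- The partial derivative `X_j = ∂X/∂θ^j`. -/
noncomputable def partialDeriv (X : EuclideanSpace ℝ (Fin q) → V) (j : Fin q)
    (θ : EuclideanSpace ℝ (Fin q)) : V :=
  fderiv ℝ X θ (EuclideanSpace.single j 1)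

/-- The metric tensor `g_{ij} = (X_i, X_j)`. -/
noncomputable def metricTensor (X : EuclideanSpace ℝ (Fin q) → V)
    (θ : EuclideanSpace ℝ (Fin q)) : Matrix (Fin q) (Fin q) ℝ :=
  Matrix.of fun i j => inner ℝ (partialDeriv X i θ) (partialDeriv X j θ)

/-- `X : Θ → S ∩ O` is a `C^k`-smooth local parametrization of the set `S` on its relatively open
piece `S ∩ O`: a homeomorphism of a domain `Θ ⊂ ℝ^q` onto `S ∩ O` which is `C^k` with
nondegenerate metric tensor. -/
structure IsLocalParam (k : WithTop ℕ∞) (S O : Set V) (Θ : Set (EuclideanSpace ℝ (Fin q)))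
    (X : EuclideanSpace ℝ (Fin q) → V) : Prop where
  isOpen_target : IsOpen O
  isOpen_domain : IsOpen Θ
  isConnected_domain : IsConnected Θ
  isEmbedding : Topology.IsEmbedding (Θ.domRestrict X)
  image_eq : X '' Θ = S ∩ O
  contDiffOn : ContDiffOn ℝ k X Θ
  det_metricTensor_ne_zero : ∀ θ ∈ Θ, (metricTensor X θ).det ≠ 0

/-- A `C^k`-smooth surface of dimension `q`: a connected set with a `C^k`-smooth local
parametrization of `Γ ∩ B_r(M)`, for some `r > 0`, at each of its points `M`. -/
def IsSmoothSurface (q : ℕ) (k : WithTop ℕ∞) (Γ : Set V) : Prop :=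
  IsConnected Γ ∧ ∀ M ∈ Γ, ∃ r : ℝ, 0 < r ∧
    ∃ (Θ : Set (EuclideanSpace ℝ (Fin q))) (X : EuclideanSpace ℝ (Fin q) → V),
      IsLocalParam k Γ (Metric.ball M r) Θ X

/-- `ν` is a continuous field of unit normals on the `q`-dimensional surface `Γ`. For a hypersurface
such a field is an orientation. -/
def IsUnitNormalField (q : ℕ) (Γ : Set V) (ν : V → V) : Prop :=
  ContinuousOn ν Γ ∧ (∀ M ∈ Γ, ‖ν M‖ = 1) ∧
    ∀ (O : Set V) (Θ : Set (EuclideanSpace ℝ (Fin q))) (X : EuclideanSpace ℝ (Fin q) → V),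
      IsLocalParam 2 Γ O Θ X → ∀ θ ∈ Θ, ∀ j, inner ℝ (partialDeriv X j θ) (ν (X θ)) = 0

/-- `τ` is an admissible `C^1` matrix field for the parametrization `X`: `τ τᵀ = g⁻¹` on `Θ`.
These are the matrices `τ = g^{-1/2} B` with `B` orthogonal. -/
def IsFrameMatrix (Θ : Set (EuclideanSpace ℝ (Fin q))) (X : EuclideanSpace ℝ (Fin q) → V)
    (τ : EuclideanSpace ℝ (Fin q) → Matrix (Fin q) (Fin q) ℝ) : Prop :=
  (∀ i j, ContDiffOn ℝ 1 (fun θ => τ θ i j) Θ) ∧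
    ∀ θ ∈ Θ, τ θ * (τ θ).transpose = (metricTensor X θ)⁻¹

/-- The invariant derivative `F_(j) = F_k τ^k_j`. -/
noncomputable def invDeriv (τ : EuclideanSpace ℝ (Fin q) → Matrix (Fin q) (Fin q) ℝ)
    (F : EuclideanSpace ℝ (Fin q) → V) (j : Fin q) (θ : EuclideanSpace ℝ (Fin q)) : V :=
  ∑ k, τ θ k j • partialDeriv F k θ

/-- The matrix `K_{ij} = (X_(i)(j), N)` built from the second invariant derivatives of the position
vector, `N` being a unit normal at the point under consideration. -/
noncomputable def curvatureMatrix (X : EuclideanSpace ℝ (Fin q) → V)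
    (τ : EuclideanSpace ℝ (Fin q) → Matrix (Fin q) (Fin q) ℝ) (N : V)
    (θ : EuclideanSpace ℝ (Fin q)) : Matrix (Fin q) (Fin q) ℝ :=
  Matrix.of fun i j => inner ℝ (invDeriv τ (invDeriv τ X i) j θ) N

/-- `K` is a curvature matrix at the point `M` of the set `S`, which near `M` is a `q`-dimensional
`C^2`-smooth hypersurface with unit normal `N` at `M`: it is computed in some local parametrization
of `S` near `M` and with some admissible `τ`. Different choices give orthogonally similar
matrices. -/
def IsCurvatureMatrix (S : Set V) (M N : V) (K : Matrix (Fin q) (Fin q) ℝ) : Prop :=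
  ∃ (O : Set V) (Θ : Set (EuclideanSpace ℝ (Fin q))) (X : EuclideanSpace ℝ (Fin q) → V)
    (τ : EuclideanSpace ℝ (Fin q) → Matrix (Fin q) (Fin q) ℝ) (θ : EuclideanSpace ℝ (Fin q)),
    IsLocalParam 2 S O Θ X ∧ IsFrameMatrix Θ X τ ∧ θ ∈ Θ ∧ X θ = M ∧
      K = curvatureMatrix X τ N θ

/-- The `p`-curvature `k_p[S](M)` of the `q`-dimensional hypersurface `S`, with unit normal `N` at
`M`, exists and equals `c`: it is the `p`-trace of the curvature matrix. -/
def HasPCurvature (q p : ℕ) (S : Set V) (M N : V) (c : ℝ) : Prop :=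
  ∃ K : Matrix (Fin q) (Fin q) ℝ, IsCurvatureMatrix S M N K ∧ pTrace p K = c

/-- `M` is a point of `m`-convexity of the `q`-dimensional hypersurface `S`, with unit normal `N`
at `M`: the curvature matrix at `M` is `m`-positive. -/
def IsMConvexAt (q m : ℕ) (S : Set V) (M N : V) : Prop :=
  ∃ K : Matrix (Fin q) (Fin q) ℝ, IsCurvatureMatrix S M N K ∧ IsMPositive m K

/-- `L` is a `q`-direction at the point `M` of the `n`-dimensional surface `Γ`: it is spanned by
`l_i = X_(k) η^k_i`, `i = 1, …, q`, for an `n × q` matrix `η` with `ηᵀ η = I`. -/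
def IsDirection (n q : ℕ) (Γ : Set V) (M : V) (L : Submodule ℝ V) : Prop :=
  ∃ (O : Set V) (Θ : Set (EuclideanSpace ℝ (Fin n))) (X : EuclideanSpace ℝ (Fin n) → V)
    (τ : EuclideanSpace ℝ (Fin n) → Matrix (Fin n) (Fin n) ℝ) (θ : EuclideanSpace ℝ (Fin n))
    (η : Matrix (Fin n) (Fin q) ℝ),
    IsLocalParam 2 Γ O Θ X ∧ IsFrameMatrix Θ X τ ∧ θ ∈ Θ ∧ X θ = M ∧ η.transpose * η = 1 ∧
      L = Submodule.span ℝ (Set.range fun i => ∑ k, η k i • invDeriv τ X k θ)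

/-- The direction space of the normal sectional plane through `M` that contains the normal `N`
and the direction `L`. It inherits the Euclidean structure of `V`. -/
def sectionalPlane (N : V) (L : Submodule ℝ V) : Submodule ℝ V :=
  Submodule.span ℝ {N} ⊔ L

/-- The normal section of `Γ` at `M` as a subset of the sectional plane, the latter being regarded
as a Euclidean space with origin at `M`. -/
def normalSection (Γ : Set V) (M N : V) (L : Submodule ℝ V) : Set (sectionalPlane N L) :=
  {w | M + (w : V) ∈ Γ}

/-- The normal `N` as a vector of the sectional plane: the unit normal at the origin of the normal
section. -/
def sectionNormal (N : V) (L : Submodule ℝ V) : sectionalPlane N L :=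
  ⟨N, Submodule.mem_sup_left (Submodule.mem_span_singleton_self N)⟩

end Surfaces

end SurfaceGeometry

open SurfaceGeometry

/-! ### Algebra of `m`-positive symmetric matrices. -/

namespace SurfaceGeometry

open Polynomial Matrix

/-! Suppose that some point of the hypersurface is a point of `m`-convexity. Two facts lead to a
contradiction.

Propagation: among symmetric matrices with `T_m > 0`, the `m`-positive ones form an open and closed
set. Closedness is the substantial half (`isMPositive_of_nonneg`); it rests on the real-rootedness
of the characteristic polynomial and its derivatives. Since `k_m > 0` and the hypersurface is
connected, `m`-convexity spreads to every point, including `M₀` (`isMConvexAt_of_forall_pos`).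

Restriction: the normal section lies in the hypersurface and shares its normal at `M₀`, so its
curvature matrix is a compression `ηᵀ K η` with `ηᵀ η = 1` (`exists_curvatureMatrix_eq`).
Compressing an `m`-positive matrix to codimension `p` leaves an `(m-p)`-positive one
(`IsMPositive.compression`). Hence the `(m-p)`-curvature of the section at `M₀` is positive, not
zero. -/

theorem coeff_charpoly_neg {n p : ℕ} (hp : p ≤ n) (S : Matrix (Fin n) (Fin n) ℝ) :
    (-S).charpoly.coeff (n - p) = pTrace p S := by
  have h := Matrix.charpoly_coeff_eq_sum_minors (-S) p (by simpa using hp)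
  rw [Fintype.card_fin] at h
  rw [h, pTrace, Finset.mul_sum]
  refine Finset.sum_congr rfl fun s hs => ?_
  rw [Matrix.submatrix_neg, Pi.neg_apply, Pi.neg_apply, Matrix.det_neg, Fintype.card_coe,
    (Finset.mem_powersetCard.mp hs).2, ← mul_assoc, ← mul_pow]
  simp

/-- A second generating function beside `det (x + S)`: this one suits row operations on `S`, while
the characteristic polynomial supplies real roots. -/
theorem pTrace_eq_coeff {n : ℕ} (p : ℕ) (S : Matrix (Fin n) (Fin n) ℝ) :
    pTrace p S = (det (1 + (X : ℝ[X]) • S.map C)).coeff p :=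
  (Matrix.coeff_det_one_add_X_smul_eq_sum_minors S p).symm

theorem pTrace_zero {n : ℕ} (S : Matrix (Fin n) (Fin n) ℝ) : pTrace 0 S = 1 := by
  simp [pTrace]

theorem pTrace_one {n : ℕ} (S : Matrix (Fin n) (Fin n) ℝ) : pTrace 1 S = S.trace := by
  rw [pTrace_eq_coeff, coeff_det_one_add_X_smul_one]

/-- Rolle's theorem with multiplicities: differentiation loses at most one real root, and the degree
drops by at least one when it is positive. -/
theorem splits_derivative {f : ℝ[X]} (hf : f.Splits) : (derivative f).Splits := by
  rw [splits_iff_card_roots] at hf ⊢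
  refine le_antisymm (card_roots' _) ?_
  have h1 := card_roots_le_derivative f
  have h2 := natDegree_derivative_le f
  omega

theorem splits_iterate_derivative {f : ℝ[X]} (hf : f.Splits) (k : ℕ) :
    (derivative^[k] f).Splits := by
  induction k with
  | zero => exact hf
  | succ k ih => rw [Function.iterate_succ_apply']; exact splits_derivative ih

/-- Nonnegativity at all indices is carried along because the new leading coefficient involves an
old coefficient beyond the degree. -/
theorem coeff_prod_X_add_C_pos (s : Multiset ℝ) (hs : ∀ a ∈ s, 0 < a) :
    (∀ i, 0 ≤ ((s.map fun a => X + C a).prod).coeff i) ∧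
      ∀ i ≤ Multiset.card s, 0 < ((s.map fun a => X + C a).prod).coeff i := by
  induction s using Multiset.induction_on with
  | empty =>
    constructor
    · intro i
      simp only [Multiset.map_zero, Multiset.prod_zero, coeff_one]
      split_ifs <;> norm_num
    · intro i hi
      have : i = 0 := by simpa using hi
      simp [this]
  | cons a s ih =>
    obtain ⟨h1, h2⟩ := ih fun b hb => hs b (Multiset.mem_cons_of_mem hb)
    have ha : 0 < a := hs a (Multiset.mem_cons_self a s)
    simp only [Multiset.map_cons, Multiset.prod_cons, Multiset.card_cons]
    constructor
    · rintro (_ | i)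
      · rw [add_mul, coeff_add, coeff_X_mul_zero, coeff_C_mul, zero_add]
        exact mul_nonneg ha.le (h1 0)
      · rw [add_mul, coeff_add, coeff_X_mul, coeff_C_mul]
        exact add_nonneg (h1 i) (mul_nonneg ha.le (h1 _))
    · rintro (_ | i) hi
      · rw [add_mul, coeff_add, coeff_X_mul_zero, coeff_C_mul, zero_add]
        exact mul_pos ha (h2 0 (Nat.zero_le _))
      · rw [add_mul, coeff_add, coeff_X_mul, coeff_C_mul]
        exact add_pos_of_pos_of_nonneg (h2 i (by omega)) (mul_nonneg ha.le (h1 _))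

/-- A real-rooted polynomial with nonnegative coefficients and positive constant term has positive
coefficients up to its degree. -/
theorem coeff_pos_of_splits {f : ℝ[X]} (hf : f.Splits) (h0 : 0 < f.coeff 0)
    (hnn : ∀ i, 0 ≤ f.coeff i) {i : ℕ} (hi : i ≤ f.natDegree) : 0 < f.coeff i := by
  have hne : f ≠ 0 := by rintro rfl; simp at h0
  have hroot : ∀ r ∈ f.roots, r < 0 := by
    intro r hr
    by_contra! hr0
    have he : f.eval r = 0 := (mem_roots'.mp hr).2
    rw [eval_eq_sum_range, Finset.sum_range_succ'] at he
    have : 0 ≤ ∑ k ∈ Finset.range f.natDegree, f.coeff (k + 1) * r ^ (k + 1) :=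
      Finset.sum_nonneg fun k _ => mul_nonneg (hnn _) (pow_nonneg hr0 _)
    simp only [pow_zero, mul_one] at he
    linarith
  have hlc : 0 < f.leadingCoeff :=
    lt_of_le_of_ne (hnn _) (Ne.symm (leadingCoeff_ne_zero.mpr hne))
  have hprod : f = C f.leadingCoeff * ((f.roots.map fun r => -r).map fun a => X + C a).prod := by
    conv_lhs => rw [hf.eq_prod_roots]
    congr 2
    rw [Multiset.map_map]
    refine Multiset.map_congr rfl fun r _ => ?_
    simp [sub_eq_add_neg]
  rw [hprod, coeff_C_mul]
  refine mul_pos hlc ((coeff_prod_X_add_C_pos _ ?_).2 i ?_)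
  · intro a ha
    obtain ⟨r, hr, rfl⟩ := Multiset.mem_map.mp ha
    exact neg_pos.mpr (hroot r hr)
  · rw [Multiset.card_map]
    rwa [hf.natDegree_eq_card_roots] at hi

theorem splits_charpoly_of_isSymm {n : ℕ} {S : Matrix (Fin n) (Fin n) ℝ} (hS : S.IsSymm) :
    S.charpoly.Splits :=
  Matrix.IsHermitian.splits_charpoly (by
    rw [Matrix.IsHermitian, Matrix.conjTranspose_eq_transpose_of_trivial]; exact hS)

/-- The part of the closure of the cone of `m`-positive matrices on which `T_m` is positive
consists of `m`-positive matrices. -/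
theorem isMPositive_of_nonneg {n m : ℕ} (hmn : m ≤ n) {S : Matrix (Fin n) (Fin n) ℝ}
    (hS : S.IsSymm) (hm : 0 < pTrace m S) (hnn : ∀ p ≤ m, 0 ≤ pTrace p S) : IsMPositive m S := by
  refine ⟨hS, fun p hp => ?_⟩
  -- Differentiating `det (x + S)` exactly `n - m` times removes every `T_p` with `p > m`. What
  -- remains has coefficients that are positive multiples of `T_m, …, T_0`, with `T_m` in the
  -- constant term.
  set f : ℝ[X] := derivative^[n - m] (-S).charpoly with hf
  have hsp : f.Splits := splits_iterate_derivative (splits_charpoly_of_isSymm hS.neg) _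
  have hdeg : (-S).charpoly.natDegree = n := by
    simp [Matrix.charpoly_natDegree_eq_dim]
  have hcoeff : ∀ j ≤ m, f.coeff j = (j + (n - m)).descFactorial (n - m) * pTrace (m - j) S := by
    intro j hj
    rw [hf, coeff_iterate_derivative, nsmul_eq_mul, ← coeff_charpoly_neg (by omega) S]
    congr 2
    omega
  have hbig : ∀ j, m < j → f.coeff j = 0 := by
    intro j hj
    rw [hf, coeff_iterate_derivative, coeff_eq_zero_of_natDegree_lt (by omega), smul_zero]
  have hd : ∀ j, (0 : ℝ) < ((j + (n - m)).descFactorial (n - m) : ℕ) := fun j =>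
    Nat.cast_pos.mpr (Nat.pos_of_ne_zero fun h => by
      rw [Nat.descFactorial_eq_zero_iff_lt] at h; omega)
  have hfnn : ∀ i, 0 ≤ f.coeff i := by
    intro i
    rcases le_or_gt i m with hi | hi
    · rw [hcoeff i hi]; exact mul_nonneg (hd i).le (hnn _ (Nat.sub_le _ _))
    · exact (hbig i hi).ge
  have hf0 : 0 < f.coeff 0 := by
    rw [hcoeff 0 (Nat.zero_le _)]; exact mul_pos (hd 0) hm
  have hfm : m ≤ f.natDegree := by
    refine le_natDegree_of_ne_zero ?_
    rw [hcoeff m le_rfl, Nat.sub_self, pTrace_zero, mul_one]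
    exact (hd m).ne'
  have := coeff_pos_of_splits hsp hf0 hfnn (i := m - p) (by omega)
  rw [hcoeff _ (Nat.sub_le _ _), Nat.sub_sub_self hp] at this
  exact pos_of_mul_pos_right this (hd _).le

theorem continuous_pTrace {n : ℕ} (p : ℕ) :
    Continuous fun S : Matrix (Fin n) (Fin n) ℝ => pTrace p S := by
  unfold pTrace
  exact continuous_finsetSum _ fun s _ =>
    (continuous_id.matrix_submatrix _ _).matrix_det

open Topology Filter in
/-- Along a connected family of symmetric matrices with `T_m > 0`, `m`-positivity at one
parameter propagates to all parameters. -/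
theorem isMPositive_of_isPreconnected {α : Type*} [TopologicalSpace α] {s : Set α}
    (hs : IsPreconnected s) {n m : ℕ} (hmn : m ≤ n) {K : α → Matrix (Fin n) (Fin n) ℝ}
    (hK : ContinuousOn K s) (hsymm : ∀ x ∈ s, (K x).IsSymm) (hpos : ∀ x ∈ s, 0 < pTrace m (K x))
    {x y : α} (hx : x ∈ s) (hy : y ∈ s) (hKx : IsMPositive m (K x)) : IsMPositive m (K y) := by
  have hT : ∀ p, ContinuousOn (fun x => pTrace p (K x)) s := fun p =>
    (continuous_pTrace p).comp_continuousOn hK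
  have key : IsMPositive m (K x) ↔ IsMPositive m (K y) := by
    refine hs.induction₂ (fun x y => IsMPositive m (K x) ↔ IsMPositive m (K y)) ?_ ?_ ?_ hx hy
    · intro x hx
      by_cases h : IsMPositive m (K x)
      · have : ∀ᶠ y in 𝓝[s] x, ∀ p ∈ Set.Iic m, 0 < pTrace p (K y) :=
          (eventually_all_finite (Set.finite_Iic m)).mpr fun p hp =>
            (hT p x hx).eventually_const_lt (h.2 p hp)
        filter_upwards [this, self_mem_nhdsWithin] with y hy hys
        exact iff_of_true h ⟨hsymm y hys, hy⟩
      -- Failure of `m`-positivity gives only `T_p ≤ 0`; as `T_m > 0`, some `T_p` must be strictly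
      -- negative, which is an open condition.
      · have : ∃ p ≤ m, pTrace p (K x) < 0 := by
          by_contra! hcon
          exact h (isMPositive_of_nonneg hmn (hsymm x hx) (hpos x hx) hcon)
        obtain ⟨p, hp, hlt⟩ := this
        filter_upwards [(hT p x hx).eventually_lt_const hlt] with y hy
        exact iff_of_false h fun hc => absurd (hc.2 p hp) hy.not_gt
    · intro _ _ _ _ _ _ h1 h2; exact h1.trans h2
    · intro _ _ _ _ h; exact h.symm
  exact key.mp hKx

/-- The determinant is linear in the last row, so `T_{p+1}` is affine in the last diagonal entry;
the slope collects the minors containing that entry. -/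
theorem pTrace_succ_add_single {n : ℕ} (p : ℕ) (S : Matrix (Fin (n + 1)) (Fin (n + 1)) ℝ) (t : ℝ) :
    pTrace (p + 1) (S + Matrix.single (Fin.last n) (Fin.last n) t) =
      pTrace (p + 1) S + t * pTrace p (S.submatrix Fin.castSucc Fin.castSucc) := by
  simp only [pTrace_eq_coeff]
  set A : Matrix (Fin (n + 1)) (Fin (n + 1)) ℝ[X] := 1 + (X : ℝ[X]) • S.map C with hA
  have h1 : 1 + (X : ℝ[X]) • (S + Matrix.single (Fin.last n) (Fin.last n) t).map C =
      A.updateRow (Fin.last n)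
        (A (Fin.last n) + (X * C t) • Pi.single (Fin.last n) (1 : ℝ[X])) := by
    ext1 i j
    rcases eq_or_ne i (Fin.last n) with rfl | hi
    · rcases eq_or_ne j (Fin.last n) with rfl | hj
      · simp [hA, mul_add, add_assoc]
      · simp [hA, hj, hj.symm]
    · simp [hA, hi, hi.symm]
  have h2 : A.submatrix Fin.castSucc Fin.castSucc =
      1 + (X : ℝ[X]) • (S.submatrix Fin.castSucc Fin.castSucc).map C := by
    ext1 i j
    simp [hA, Matrix.one_apply]
  rw [h1, det_updateRow_add, updateRow_eq_self, det_updateRow_smul, ← adjugate_apply,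
    adjugate_fin_succ_eq_det_submatrix, Fin.succAbove_last, h2, coeff_add, mul_assoc,
    coeff_X_mul, coeff_C_mul]
  simp [← two_mul]

/-- Deleting the last row and column of an `(m+1)`-positive matrix leaves an `m`-positive one. -/
theorem IsMPositive.submatrix_castSucc {n m : ℕ} (hmn : m ≤ n)
    {S : Matrix (Fin (n + 1)) (Fin (n + 1)) ℝ} (hS : IsMPositive (m + 1) S) :
    IsMPositive m (S.submatrix Fin.castSucc Fin.castSucc) := by
  refine ⟨hS.1.submatrix _, fun p hp => ?_⟩
  by_contra! hle
  -- If the slope is nonpositive, lowering the corner entry never decreases `T_{p+1}`, so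
  -- `(p+1)`-positivity persists along the whole ray `t ≤ 0`. At `t = -S.trace` the trace is zero,
  -- contradicting `T_1 > 0`.
  set K : ℝ → Matrix (Fin (n + 1)) (Fin (n + 1)) ℝ :=
    fun t => S + Matrix.single (Fin.last n) (Fin.last n) t with hKdef
  have hK : Continuous K := by
    refine continuous_const.add (continuous_pi fun i => continuous_pi fun j => ?_)
    simp only [Matrix.single_apply]
    split_ifs
    exacts [continuous_id, continuous_const]
  have hKsymm : ∀ t, (K t).IsSymm := fun t => by
    rw [Matrix.IsSymm, hKdef]
    simp [hS.1.eq]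
  have hp1 : IsMPositive (p + 1) S := ⟨hS.1, fun q hq => hS.2 q (by omega)⟩
  have hKpos : ∀ t ∈ Set.Iic (0 : ℝ), 0 < pTrace (p + 1) (K t) := fun t ht => by
    rw [hKdef, pTrace_succ_add_single]
    exact add_pos_of_pos_of_nonneg (hp1.2 _ le_rfl) (mul_nonneg_of_nonpos_of_nonpos ht hle)
  have hK0 : K 0 = S := by simp [hKdef]
  have htr : 0 < S.trace := by rw [← pTrace_one]; exact hp1.2 1 (by omega)
  have := isMPositive_of_isPreconnected isPreconnected_Iic (by omega : p + 1 ≤ n + 1)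
    hK.continuousOn (fun t _ => hKsymm t) hKpos (x := 0) (y := -S.trace) (by simp)
    (by simpa using htr.le) (by rwa [hK0])
  have h1 := this.2 1 (by omega)
  rw [pTrace_one, hKdef] at h1
  simp at h1

theorem IsMPositive.submatrix_castAdd {q m : ℕ} (p : ℕ) (hmq : m ≤ q)
    {S : Matrix (Fin (q + p)) (Fin (q + p)) ℝ} (hS : IsMPositive (m + p) S) :
    IsMPositive m (S.submatrix (Fin.castAdd p) (Fin.castAdd p)) := by
  induction p with
  | zero => exact hS
  | succ p ih =>
    exact ih (S := S.submatrix Fin.castSucc Fin.castSucc)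
      (IsMPositive.submatrix_castSucc (by omega) hS)

theorem pTrace_transpose_mul_mul {n : ℕ} {U : Matrix (Fin n) (Fin n) ℝ} (hU : Uᵀ * U = 1) (p : ℕ)
    (S : Matrix (Fin n) (Fin n) ℝ) : pTrace p (Uᵀ * S * U) = pTrace p S := by
  rcases le_or_gt p n with hp | hp
  · rw [← coeff_charpoly_neg hp, ← coeff_charpoly_neg hp]
    have hU' : U * Uᵀ = 1 := mul_eq_one_comm.mp hU
    have : -(Uᵀ * S * U) = Uᵀ * (-S * U) := by simp [Matrix.mul_assoc]
    rw [this, Matrix.charpoly_mul_comm, Matrix.mul_assoc, hU', Matrix.mul_one]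
  · have : (Finset.univ : Finset (Fin n)).powersetCard p = ∅ :=
      Finset.powersetCard_eq_empty.mpr (by simpa using hp)
    simp [pTrace, this]

theorem IsMPositive.transpose_mul_mul {n m : ℕ} {U : Matrix (Fin n) (Fin n) ℝ} (hU : Uᵀ * U = 1)
    {S : Matrix (Fin n) (Fin n) ℝ} (hS : IsMPositive m S) : IsMPositive m (Uᵀ * S * U) :=
  ⟨by rw [Matrix.IsSymm]; simp [Matrix.mul_assoc, hS.1.eq],
    fun p hp => by rw [pTrace_transpose_mul_mul hU]; exact hS.2 p hp⟩

/-- A matrix with orthonormal columns consists of the first columns of an orthogonal matrix. -/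
theorem exists_orthogonal_extension {q p : ℕ} {η : Matrix (Fin (q + p)) (Fin q) ℝ}
    (hη : ηᵀ * η = 1) :
    ∃ U : Matrix (Fin (q + p)) (Fin (q + p)) ℝ, Uᵀ * U = 1 ∧
      ∀ i j, U i (Fin.castAdd p j) = η i j := by
  -- The zero columns are placeholders; only the restriction of `v` to the first `q` indices has to
  -- be orthonormal.
  let v : Fin (q + p) → EuclideanSpace ℝ (Fin (q + p)) :=
    fun j => WithLp.toLp 2 fun i => Fin.addCases (fun j => η i j) (fun _ => 0) j
  have hvη : ∀ i j, v (Fin.castAdd p j) i = η i j := fun i j =>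
    Fin.addCases_left (motive := fun _ => ℝ) (left := fun j => η i j) (right := fun _ => 0) j
  have hv : Orthonormal ℝ ((Set.range (Fin.castAdd (n := q) p)).domRestrict v) := by
    rw [orthonormal_iff_ite]
    rintro ⟨x, hx⟩ ⟨y, hy⟩
    obtain ⟨a, rfl⟩ := id hx
    obtain ⟨b, rfl⟩ := id hy
    have h := congrFun (congrFun hη a) b
    rw [Matrix.mul_apply, Matrix.one_apply] at h
    simp only [Subtype.mk.injEq, Fin.castAdd_inj]
    rw [← h, Set.domRestrict_apply, Set.domRestrict_apply, PiLp.inner_apply]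
    exact Finset.sum_congr rfl fun i _ => by simp [hvη, mul_comm]
  obtain ⟨b, hb⟩ := hv.exists_orthonormalBasis_extension_of_card_eq (by simp)
  refine ⟨Matrix.of fun i j => b j i, ?_, fun i j => ?_⟩
  · ext i j
    rw [Matrix.mul_apply, Matrix.one_apply, ← orthonormal_iff_ite.mp b.orthonormal i j,
      PiLp.inner_apply]
    exact Finset.sum_congr rfl fun k _ => by simp [mul_comm]
  · rw [Matrix.of_apply, hb _ ⟨j, rfl⟩]
    exact hvη i j

/-- The compression of an `(m+p)`-positive matrix to a subspace of codimension `p` is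
`m`-positive. -/
theorem IsMPositive.compression {q p m : ℕ} (hmq : m ≤ q)
    {S : Matrix (Fin (q + p)) (Fin (q + p)) ℝ} (hS : IsMPositive (m + p) S)
    {η : Matrix (Fin (q + p)) (Fin q) ℝ} (hη : ηᵀ * η = 1) : IsMPositive m (ηᵀ * S * η) := by
  obtain ⟨U, hU, hUη⟩ := exists_orthogonal_extension hη
  have h := (hS.transpose_mul_mul hU).submatrix_castAdd p hmq
  have : (Uᵀ * S * U).submatrix (Fin.castAdd p) (Fin.castAdd p) = ηᵀ * S * η := by
    ext i j
    simp [Matrix.mul_apply, hUη]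
  rwa [this] at h

end SurfaceGeometry

/-! ### Second-order expansions and lifting of curves. -/

namespace SurfaceGeometry

open Topology Filter Asymptotics

section SecondOrder

variable {E F : Type*} [NormedAddCommGroup E] [NormedSpace ℝ E] [NormedAddCommGroup F]

/-- Second-order Taylor expansion of a `C^2` map. -/
theorem isLittleO_second_order [NormedSpace ℝ F] {f : E → F} {x : E} (hf : ContDiffAt ℝ 2 f x) :
    (fun d => f (x + d) - f x - fderiv ℝ f x d - (2⁻¹ : ℝ) • fderiv ℝ (fderiv ℝ f) x d d)
      =o[𝓝 0] fun d => ‖d‖ ^ 2 := by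
  have hsymm : IsSymmSndFDerivAt ℝ f x := hf.isSymmSndFDerivAt (by simp)
  have hf1 : ContDiffAt ℝ 1 (fderiv ℝ f) x := hf.fderiv_right (by norm_num)
  have hD : HasFDerivAt (fderiv ℝ f) (fderiv ℝ (fderiv ℝ f) x) x :=
    (hf1.differentiableAt (by norm_num)).hasFDerivAt
  have hev : ∀ᶠ d in 𝓝 (0 : E), DifferentiableAt ℝ f (x + d) := by
    have h1 : ∀ᶠ y in 𝓝 x, DifferentiableAt ℝ f y :=
      (hf.eventually (by simp)).mono fun y hy => hy.differentiableAt (by norm_num)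
    have h2 : Tendsto (fun d : E => x + d) (𝓝 0) (𝓝 x) := by
      have h3 : Continuous fun d : E => x + d := by fun_prop
      simpa using h3.tendsto 0
    exact h2.eventually h1
  rw [isLittleO_iff]
  intro ε hε
  have h3 := (hasFDerivAt_iff_isLittleO_nhds_zero.mp hD).def hε
  obtain ⟨r, hr, hball⟩ := Metric.eventually_nhds_iff_ball.mp (hev.and h3)
  filter_upwards [Metric.ball_mem_nhds (0 : E) hr] with d hd
  -- By symmetry of the second derivative, the remainder `g` has derivative `f'(x+y) - f'(x) -
  -- f''(x)y`, of norm at most `ε‖d‖` on the ball of radius `‖d‖`. The mean value inequality then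
  -- yields `ε‖d‖²`.
  set g : E → F := fun d => f (x + d) - f x - fderiv ℝ f x d
    - (2⁻¹ : ℝ) • fderiv ℝ (fderiv ℝ f) x d d with hg
  have hsub : Metric.closedBall (0 : E) ‖d‖ ⊆ Metric.ball 0 r :=
    Metric.closedBall_subset_ball (by simpa using hd)
  have hgd : ∀ y ∈ Metric.closedBall (0 : E) ‖d‖, HasFDerivWithinAt g
      (fderiv ℝ f (x + y) - fderiv ℝ f x - fderiv ℝ (fderiv ℝ f) x y)
      (Metric.closedBall 0 ‖d‖) y := by
    intro y hy
    have hy1 := (hball y (hsub hy)).1.hasFDerivAt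
    have e1 : HasFDerivAt (fun d => f (x + d)) (fderiv ℝ f (x + y)) y :=
      (hy1.comp y ((hasFDerivAt_id y).const_add x)).congr_fderiv (by ext; rfl)
    have e2 : HasFDerivAt (fun d => fderiv ℝ (fderiv ℝ f) x d d)
        ((fderiv ℝ (fderiv ℝ f) x y).comp (ContinuousLinearMap.id ℝ E) +
          (fderiv ℝ (fderiv ℝ f) x).flip y) y :=
      (fderiv ℝ (fderiv ℝ f) x).hasFDerivAt.clm_apply (hasFDerivAt_id y)
    refine (((e1.sub_const (f x)).sub (fderiv ℝ f x).hasFDerivAt).sub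
      (e2.const_smul (2⁻¹ : ℝ))).hasFDerivWithinAt.congr_fderiv ?_
    ext v
    have hs := hsymm v y
    simp only [sub_apply, smul_apply, add_apply, ContinuousLinearMap.comp_id, ContinuousLinearMap.flip_apply,
      hs, ← two_smul ℝ (fderiv ℝ (fderiv ℝ f) x y v), smul_smul]
    norm_num
  have hb : ∀ y ∈ Metric.closedBall (0 : E) ‖d‖,
      ‖fderiv ℝ f (x + y) - fderiv ℝ f x - fderiv ℝ (fderiv ℝ f) x y‖ ≤ ε * ‖d‖ := by
    intro y hy
    refine ((hball y (hsub hy)).2).trans ?_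
    gcongr
    simpa using hy
  have hmv := (convex_closedBall (0 : E) ‖d‖).norm_image_sub_le_of_norm_hasFDerivWithin_le hgd hb
    (Metric.mem_closedBall_self (norm_nonneg d)) (by simp : d ∈ Metric.closedBall (0 : E) ‖d‖)
  have hg0 : g 0 = 0 := by simp [hg]
  rw [hg0, sub_zero, sub_zero] at hmv
  simpa [sq, mul_assoc] using hmv

/-- The second-order height, in a normal direction, of a curve on a `C^2` surface. -/
theorem tendsto_inner_div_sq [InnerProductSpace ℝ F] {X : E → F} {θ a : E}
    (hX : ContDiffAt ℝ 2 X θ) {N : F} (hN : ∀ v, inner ℝ (fderiv ℝ X θ v) N = 0) {γ : ℝ → E}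
    (hγ : HasDerivAt γ a 0) (hγ0 : γ 0 = θ) :
    Tendsto (fun s : ℝ => (s ^ 2)⁻¹ * inner ℝ (X (γ s) - X θ) N) (𝓝[≠] 0)
      (𝓝 (2⁻¹ * inner ℝ (fderiv ℝ (fderiv ℝ X) θ a a) N)) := by
  set D := fderiv ℝ (fderiv ℝ X) θ with hDdef
  -- The linear term is tangent, so the normal `N` kills it. Hence one derivative of `γ` at `0`
  -- suffices for a second-order limit.
  set R : E → F := fun d => X (θ + d) - X θ - fderiv ℝ X θ d - (2⁻¹ : ℝ) • D d d with hR
  have hslope : Tendsto (fun s : ℝ => s⁻¹ • (γ s - θ)) (𝓝[≠] 0) (𝓝 a) := by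
    have := hγ.tendsto_slope_zero
    simpa [hγ0] using this
  have hO : (fun s : ℝ => γ s - θ) =O[𝓝 0] fun s : ℝ => s := by
    have := hγ.isBigO_sub
    simpa [hγ0] using this
  have hcont : Tendsto (fun s : ℝ => γ s - θ) (𝓝 0) (𝓝 0) := by
    have := hγ.continuousAt.tendsto
    rw [hγ0] at this
    simpa using this.sub_const θ
  have hRo : (fun s : ℝ => R (γ s - θ)) =o[𝓝 0] fun s : ℝ => s ^ 2 :=
    ((isLittleO_second_order hX).comp_tendsto hcont).trans_isBigO (hO.norm_left.pow 2)
  have hRo' : (fun s : ℝ => inner ℝ (R (γ s - θ)) N) =o[𝓝 0] fun s : ℝ => s ^ 2 := by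
    refine IsBigO.trans_isLittleO (IsBigO.of_bound ‖N‖ (Eventually.of_forall fun s => ?_)) hRo
    rw [mul_comm]
    exact norm_inner_le_norm _ _
  have hR0 : Tendsto (fun s : ℝ => (s ^ 2)⁻¹ * inner ℝ (R (γ s - θ)) N) (𝓝[≠] 0) (𝓝 0) := by
    have := (hRo'.tendsto_div_nhds_zero).mono_left (nhdsWithin_le_nhds (s := {0}ᶜ))
    exact this.congr fun s => by rw [div_eq_inv_mul]
  have hQ : Tendsto (fun s : ℝ => 2⁻¹ * inner ℝ (D (s⁻¹ • (γ s - θ)) (s⁻¹ • (γ s - θ))) N)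
      (𝓝[≠] 0) (𝓝 (2⁻¹ * inner ℝ (D a a) N)) := by
    have hc : Continuous fun v : E => 2⁻¹ * (inner ℝ (D v v) N : ℝ) := by fun_prop
    exact (hc.tendsto a).comp hslope
  have := hQ.add hR0
  rw [add_zero] at this
  refine this.congr' ?_
  filter_upwards [self_mem_nhdsWithin] with s hs
  have hs : s ≠ 0 := hs
  have hXeq : X (γ s) - X θ = R (γ s - θ) + fderiv ℝ X θ (γ s - θ)
      + (2⁻¹ : ℝ) • D (γ s - θ) (γ s - θ) := by
    simp only [hR, add_sub_cancel]
    abel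
  rw [hXeq, inner_add_left, inner_add_left, hN, inner_smul_left]
  simp only [map_smul, smul_apply, inner_smul_left, conj_trivial]
  field_simp
  ring

end SecondOrder

section Param

variable {V : Type*} [NormedAddCommGroup V] [InnerProductSpace ℝ V] {q : ℕ}

theorem IsLocalParam.contDiffAt {k : WithTop ℕ∞} {S O : Set V}
    {Θ : Set (EuclideanSpace ℝ (Fin q))} {X : EuclideanSpace ℝ (Fin q) → V}
    (hX : IsLocalParam k S O Θ X) {θ : EuclideanSpace ℝ (Fin q)} (hθ : θ ∈ Θ) :
    ContDiffAt ℝ k X θ :=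
  hX.contDiffOn.contDiffAt (hX.isOpen_domain.mem_nhds hθ)

theorem fderiv_apply_eq_sum (X : EuclideanSpace ℝ (Fin q) → V) (θ a : EuclideanSpace ℝ (Fin q)) :
    fderiv ℝ X θ a = ∑ j, a j • partialDeriv X j θ := by
  conv_lhs => rw [← (EuclideanSpace.basisFun (Fin q) ℝ).sum_repr a]
  simp [partialDeriv]

theorem metricTensor_mulVec (X : EuclideanSpace ℝ (Fin q) → V) (θ a : EuclideanSpace ℝ (Fin q))
    (i : Fin q) :
    (metricTensor X θ).mulVec a i = inner ℝ (partialDeriv X i θ) (fderiv ℝ X θ a) := by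
  rw [fderiv_apply_eq_sum, inner_sum]
  simp [Matrix.mulVec, dotProduct, metricTensor, inner_smul_right, mul_comm]

theorem IsLocalParam.injective_fderiv {k : WithTop ℕ∞} {S O : Set V}
    {Θ : Set (EuclideanSpace ℝ (Fin q))} {X : EuclideanSpace ℝ (Fin q) → V}
    (hX : IsLocalParam k S O Θ X) {θ : EuclideanSpace ℝ (Fin q)} (hθ : θ ∈ Θ) :
    Function.Injective (fderiv ℝ X θ) := by
  rw [injective_iff_map_eq_zero]
  intro a ha
  have : (metricTensor X θ).mulVec a = 0 := by
    ext i
    rw [metricTensor_mulVec, ha, inner_zero_right, Pi.zero_apply]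
  have h := Matrix.eq_zero_of_mulVec_eq_zero (hX.det_metricTensor_ne_zero θ hθ) this
  ext i
  exact congrFun h i

/-- A differentiable curve on a surface lifts to the parameter domain of a local parametrization. -/
theorem IsLocalParam.exists_lift [FiniteDimensional ℝ V] {S O : Set V}
    {Θ : Set (EuclideanSpace ℝ (Fin q))} {X : EuclideanSpace ℝ (Fin q) → V}
    (hX : IsLocalParam 2 S O Θ X) {θ : EuclideanSpace ℝ (Fin q)} (hθ : θ ∈ Θ) {c : ℝ → V} {w : V}
    (hc : HasDerivAt c w 0) (hc0 : c 0 = X θ) (hcS : ∀ᶠ s in 𝓝 0, c s ∈ S) :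
    ∃ (γ : ℝ → EuclideanSpace ℝ (Fin q)) (a : EuclideanSpace ℝ (Fin q)), HasDerivAt γ a 0 ∧
      γ 0 = θ ∧ (∀ᶠ s in 𝓝 0, X (γ s) = c s) ∧ fderiv ℝ X θ a = w := by
  classical
  have hmem : ∀ᶠ s in 𝓝 (0 : ℝ), c s ∈ X '' Θ := by
    have hO : c 0 ∈ O := by
      have : X θ ∈ S ∩ O := hX.image_eq ▸ Set.mem_image_of_mem X hθ
      rw [hc0]; exact this.2
    filter_upwards [hcS, hc.continuousAt (hX.isOpen_target.mem_nhds hO)] with s h1 h2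
    rw [hX.image_eq]; exact ⟨h1, h2⟩
  set γ : ℝ → EuclideanSpace ℝ (Fin q) := fun s => Function.invFunOn X Θ (c s) with hγdef
  have hγ : ∀ᶠ s in 𝓝 (0 : ℝ), γ s ∈ Θ ∧ X (γ s) = c s :=
    hmem.mono fun s hs => ⟨Function.invFunOn_mem hs, Function.invFunOn_eq hs⟩
  have hinj : Set.InjOn X Θ := Set.injOn_iff_injective.mpr hX.isEmbedding.injective
  have hγ0 : γ 0 = θ := by
    obtain ⟨h1, h2⟩ := hγ.self_of_nhds
    exact hinj h1 hθ (h2.trans hc0)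
  -- Continuity of the lift is where the embedding property of `X` enters.
  have hγcont : Tendsto γ (𝓝 0) (𝓝 θ) := by
    intro U hU
    have hU' : ((↑) : Θ → EuclideanSpace ℝ (Fin q)) ⁻¹' U ∈ 𝓝 (⟨θ, hθ⟩ : Θ) :=
      continuous_subtype_val.continuousAt hU
    rw [hX.isEmbedding.isInducing.nhds_eq_comap, Filter.mem_comap] at hU'
    obtain ⟨W, hW, hWU⟩ := hU'
    have hcW : ∀ᶠ s in 𝓝 (0 : ℝ), c s ∈ W := hc.continuousAt (by rw [hc0]; exact hW)
    rw [Filter.mem_map]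
    filter_upwards [hγ, hcW] with s hs hsW
    exact @hWU ⟨γ s, hs.1⟩ (by
      change X (γ s) ∈ W
      rw [hs.2]; exact hsW)
  -- With `L` a left inverse of the derivative, `L ∘ X` has derivative the identity at `θ`. The
  -- inverse function theorem then makes `γ = G ∘ L ∘ c` differentiable at `0`.
  obtain ⟨l, hl⟩ := (fderiv ℝ X θ).toLinearMap.exists_leftInverse_of_injective
    (LinearMap.ker_eq_bot.mpr (hX.injective_fderiv hθ))
  set L : V →L[ℝ] EuclideanSpace ℝ (Fin q) := LinearMap.toContinuousLinearMap l with hLdef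
  have hXs : HasStrictFDerivAt X (fderiv ℝ X θ) θ :=
    (hX.contDiffAt hθ).hasStrictFDerivAt (by norm_num)
  have hf : HasStrictFDerivAt (fun x => L (X x))
      ((ContinuousLinearEquiv.refl ℝ (EuclideanSpace ℝ (Fin q)) :
        EuclideanSpace ℝ (Fin q) ≃L[ℝ] EuclideanSpace ℝ (Fin q)) :
        EuclideanSpace ℝ (Fin q) →L[ℝ] EuclideanSpace ℝ (Fin q)) θ := by
    refine (L.hasStrictFDerivAt.comp θ hXs).congr_fderiv ?_
    ext1 v
    exact LinearMap.congr_fun hl v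
  set G := hf.localInverse (fun x => L (X x)) _ θ with hG
  have hGeq : ∀ᶠ s in 𝓝 (0 : ℝ), γ s = G (L (c s)) := by
    filter_upwards [hγcont.eventually hf.eventually_left_inverse, hγ] with s h1 h2
    rw [← h2.2]
    exact h1.symm
  have hγd : HasDerivAt γ (L w) 0 := by
    have h1 : HasFDerivAt G (ContinuousLinearMap.id ℝ (EuclideanSpace ℝ (Fin q))) (L (c 0)) := by
      rw [hc0]; exact hf.to_localInverse.hasFDerivAt
    have h2 : HasDerivAt (fun s => L (c s)) (L w) 0 := L.hasFDerivAt.comp_hasDerivAt 0 hc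
    exact (h1.comp_hasDerivAt 0 h2).congr_of_eventuallyEq hGeq
  refine ⟨γ, L w, hγd, hγ0, hγ.mono fun s hs => hs.2, ?_⟩
  have h1 : HasDerivAt (fun s => X (γ s)) (fderiv ℝ X θ (L w)) 0 := by
    have h0 : HasFDerivAt X (fderiv ℝ X θ) (γ 0) := by
      rw [hγ0]; exact hXs.hasFDerivAt
    exact h0.comp_hasDerivAt 0 hγd
  exact h1.unique (hc.congr_of_eventuallyEq (hγ.mono fun s hs => hs.2))

end Param

/-! ### Curvature matrices of a surface contained in another. -/

section Comparison

variable {V W : Type*} [NormedAddCommGroup V] [InnerProductSpace ℝ V] [FiniteDimensional ℝ V]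
  [NormedAddCommGroup W] [InnerProductSpace ℝ W] {n q : ℕ}

/-- A surface `S`, isometrically embedded into a surface `Γ`, is tangent to `Γ`, and on its tangent
vectors the second fundamental forms in a common normal direction coincide. -/
theorem exists_fderiv_eq_and_second_eq {Γ O : Set V} {Θ : Set (EuclideanSpace ℝ (Fin n))}
    {X : EuclideanSpace ℝ (Fin n) → V} (hX : IsLocalParam 2 Γ O Θ X)
    {θ : EuclideanSpace ℝ (Fin n)} (hθ : θ ∈ Θ) {S O' : Set W}
    {Φ : Set (EuclideanSpace ℝ (Fin q))} {Y : EuclideanSpace ℝ (Fin q) → W}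
    (hY : IsLocalParam 2 S O' Φ Y) {φ : EuclideanSpace ℝ (Fin q)} (hφ : φ ∈ Φ)
    (ι : W →ₗᵢ[ℝ] V) (P : V) (hS : ∀ w ∈ S, P + ι w ∈ Γ) (hP : P + ι (Y φ) = X θ)
    {N : V} {N' : W} (hN' : ι N' = N) (hN : ∀ a, inner ℝ (fderiv ℝ X θ a) N = 0) :
    ∀ b, ∃ a, fderiv ℝ X θ a = ι (fderiv ℝ Y φ b) ∧
      (inner ℝ (fderiv ℝ (fderiv ℝ X) θ a a) N : ℝ) =
        inner ℝ (fderiv ℝ (fderiv ℝ Y) φ b b) N' := by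
  have hYd : HasFDerivAt Y (fderiv ℝ Y φ) φ :=
    ((hY.contDiffAt hφ).differentiableAt (by norm_num)).hasFDerivAt
  have hline : ∀ b : EuclideanSpace ℝ (Fin q), HasDerivAt (fun s : ℝ => φ + s • b) b 0 := fun b => by
    simpa using ((hasDerivAt_id (0 : ℝ)).smul_const b).const_add φ
  have hcurve : ∀ b, HasDerivAt (fun s : ℝ => P + ι (Y (φ + s • b))) (ι (fderiv ℝ Y φ b)) 0 := by
    intro b
    have h0 : HasFDerivAt Y (fderiv ℝ Y φ) (φ + (0 : ℝ) • b) := by simpa using hYd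
    exact (ι.toContinuousLinearMap.hasFDerivAt.comp_hasDerivAt 0
      (h0.comp_hasDerivAt 0 (hline b))).const_add P
  have hcS : ∀ b, ∀ᶠ s in 𝓝 (0 : ℝ), P + ι (Y (φ + s • b)) ∈ Γ := by
    intro b
    have : ∀ᶠ s in 𝓝 (0 : ℝ), φ + s • b ∈ Φ :=
      (hline b).continuousAt (hY.isOpen_domain.mem_nhds (by simpa using hφ))
    filter_upwards [this] with s hs
    have : Y (φ + s • b) ∈ S ∩ O' := hY.image_eq ▸ Set.mem_image_of_mem Y hs
    exact hS _ this.1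
  have hlift := fun b => hX.exists_lift hθ (hcurve b) (by simpa using hP) (hcS b)
  -- Tangent vectors of `S` are tangent to `Γ`, so `N'` is automatically normal to `S`.
  have hNY : ∀ b, inner ℝ (fderiv ℝ Y φ b) N' = 0 := by
    intro b
    obtain ⟨-, a, -, -, -, ha⟩ := hlift b
    rw [← ι.inner_map_map, ← ha, hN', hN]
  intro b
  obtain ⟨γ, a, hγ, hγ0, hγX, ha⟩ := hlift b
  refine ⟨a, ha, ?_⟩
  -- The same curve is measured in both parametrizations; uniqueness of the limit identifies the
  -- second fundamental forms.
  have h1 := tendsto_inner_div_sq (hX.contDiffAt hθ) hN hγ hγ0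
  have h2 := tendsto_inner_div_sq (hY.contDiffAt hφ) hNY (hline b) (by simp)
  have h3 := h2.congr' (f₂ := fun s : ℝ => (s ^ 2)⁻¹ * inner ℝ (X (γ s) - X θ) N) (by
    filter_upwards [hγX.filter_mono nhdsWithin_le_nhds] with s hs
    rw [hs, ← hP, add_sub_add_left_eq_sub, ← map_sub, ← hN', ι.inner_map_map])
  have := tendsto_nhds_unique h1 h3
  linarith

/-- The vector `τ^k_j ∂_k` of the parameter space along which the `j`-th invariant derivative is
taken. -/
noncomputable def frameVec (τ : EuclideanSpace ℝ (Fin q) → Matrix (Fin q) (Fin q) ℝ) (j : Fin q)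
    (θ : EuclideanSpace ℝ (Fin q)) : EuclideanSpace ℝ (Fin q) :=
  WithLp.toLp 2 fun k => τ θ k j

theorem invDeriv_eq_fderiv (τ : EuclideanSpace ℝ (Fin q) → Matrix (Fin q) (Fin q) ℝ)
    (F : EuclideanSpace ℝ (Fin q) → W) (j : Fin q) (θ : EuclideanSpace ℝ (Fin q)) :
    invDeriv τ F j θ = fderiv ℝ F θ (frameVec τ j θ) := by
  rw [fderiv_apply_eq_sum]
  rfl

theorem IsFrameMatrix.contDiffOn_frameVec {Θ : Set (EuclideanSpace ℝ (Fin q))}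
    {X : EuclideanSpace ℝ (Fin q) → W}
    {τ : EuclideanSpace ℝ (Fin q) → Matrix (Fin q) (Fin q) ℝ} (hτ : IsFrameMatrix Θ X τ)
    (j : Fin q) : ContDiffOn ℝ 1 (frameVec τ j) Θ :=
  contDiffOn_euclidean.mpr fun k => hτ.1 k j

/-- The curvature matrix is the matrix of the second fundamental form in the frame `τ`. -/
theorem curvatureMatrix_apply {S O : Set W} {Θ : Set (EuclideanSpace ℝ (Fin q))}
    {X : EuclideanSpace ℝ (Fin q) → W} (hX : IsLocalParam 2 S O Θ X)
    {τ : EuclideanSpace ℝ (Fin q) → Matrix (Fin q) (Fin q) ℝ} (hτ : IsFrameMatrix Θ X τ)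
    {θ : EuclideanSpace ℝ (Fin q)} (hθ : θ ∈ Θ) {N : W}
    (hN : ∀ a, inner ℝ (fderiv ℝ X θ a) N = 0) (i j : Fin q) :
    curvatureMatrix X τ N θ i j =
      inner ℝ (fderiv ℝ (fderiv ℝ X) θ (frameVec τ j θ) (frameVec τ i θ)) N := by
  have h1 : HasFDerivAt (fderiv ℝ X) (fderiv ℝ (fderiv ℝ X) θ) θ :=
    (((hX.contDiffAt hθ).fderiv_right (m := 1) (by norm_num)).differentiableAt
      (by norm_num)).hasFDerivAt
  have h2 : HasFDerivAt (frameVec τ i) (fderiv ℝ (frameVec τ i) θ) θ :=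
    (((hτ.contDiffOn_frameVec i).contDiffAt (hX.isOpen_domain.mem_nhds hθ)).differentiableAt
      (by norm_num)).hasFDerivAt
  have h3 : invDeriv τ X i = fun θ => fderiv ℝ X θ (frameVec τ i θ) :=
    funext fun θ => invDeriv_eq_fderiv τ X i θ
  rw [curvatureMatrix, Matrix.of_apply, invDeriv_eq_fderiv, h3, (h1.clm_apply h2).fderiv]
  -- The term containing the derivative of `τ` is tangent and drops out.
  simp [inner_add_left, hN]

theorem inner_fderiv_fderiv (X : EuclideanSpace ℝ (Fin q) → W)
    (θ a b : EuclideanSpace ℝ (Fin q)) :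
    inner ℝ (fderiv ℝ X θ a) (fderiv ℝ X θ b) =
      (a : Fin q → ℝ) ⬝ᵥ (metricTensor X θ).mulVec b := by
  rw [fderiv_apply_eq_sum X θ a, sum_inner]
  simp [dotProduct, metricTensor_mulVec, inner_smul_left]

section Frame

variable {S O : Set W} {Θ : Set (EuclideanSpace ℝ (Fin q))} {X : EuclideanSpace ℝ (Fin q) → W}
  {τ : EuclideanSpace ℝ (Fin q) → Matrix (Fin q) (Fin q) ℝ} {θ : EuclideanSpace ℝ (Fin q)}

theorem IsFrameMatrix.mul_transpose_mul_metricTensor (hτ : IsFrameMatrix Θ X τ)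
    (hX : IsLocalParam 2 S O Θ X) (hθ : θ ∈ Θ) :
    τ θ * ((τ θ).transpose * metricTensor X θ) = 1 := by
  rw [← Matrix.mul_assoc, hτ.2 θ hθ,
    Matrix.nonsing_inv_mul _ (isUnit_iff_ne_zero.mpr (hX.det_metricTensor_ne_zero θ hθ))]

/-- The frame is orthonormal: `τ τᵀ g = 1` gives `τᵀ g τ = 1`, one-sided inverses of square matrices
being two-sided. -/
theorem IsFrameMatrix.inner_frameVec (hτ : IsFrameMatrix Θ X τ) (hX : IsLocalParam 2 S O Θ X)
    (hθ : θ ∈ Θ) (i j : Fin q) :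
    inner ℝ (fderiv ℝ X θ (frameVec τ i θ)) (fderiv ℝ X θ (frameVec τ j θ)) =
      (1 : Matrix (Fin q) (Fin q) ℝ) i j := by
  have h := mul_eq_one_comm.mp (hτ.mul_transpose_mul_metricTensor hX hθ)
  rw [inner_fderiv_fderiv, ← h, Matrix.mul_assoc]
  rfl

theorem IsFrameMatrix.sum_inner_smul_frameVec (hτ : IsFrameMatrix Θ X τ)
    (hX : IsLocalParam 2 S O Θ X) (hθ : θ ∈ Θ) (a : EuclideanSpace ℝ (Fin q)) :
    ∑ k, (inner ℝ (fderiv ℝ X θ (frameVec τ k θ)) (fderiv ℝ X θ a) : ℝ) • frameVec τ k θ = a := by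
  have h : (τ θ).mulVec ((τ θ).transpose.mulVec ((metricTensor X θ).mulVec a)) = a := by
    rw [Matrix.mulVec_mulVec, Matrix.mulVec_mulVec, Matrix.mul_assoc,
      hτ.mul_transpose_mul_metricTensor hX hθ, Matrix.one_mulVec]
  ext i
  refine Eq.trans ?_ (congrFun h i)
  simp only [inner_fderiv_fderiv]
  simp [Matrix.mulVec, dotProduct, frameVec, mul_comm]

end Frame

/-- The curvature matrix of a surface, isometrically embedded into a surface `Γ` of dimension `n`,
in a common normal direction is a compression of the curvature matrix of `Γ`. -/
theorem exists_curvatureMatrix_eq {Γ O : Set V} {Θ : Set (EuclideanSpace ℝ (Fin n))}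
    {X : EuclideanSpace ℝ (Fin n) → V} (hX : IsLocalParam 2 Γ O Θ X)
    {τ : EuclideanSpace ℝ (Fin n) → Matrix (Fin n) (Fin n) ℝ} (hτ : IsFrameMatrix Θ X τ)
    {θ : EuclideanSpace ℝ (Fin n)} (hθ : θ ∈ Θ) {S O' : Set W}
    {Φ : Set (EuclideanSpace ℝ (Fin q))} {Y : EuclideanSpace ℝ (Fin q) → W}
    (hY : IsLocalParam 2 S O' Φ Y)
    {σ : EuclideanSpace ℝ (Fin q) → Matrix (Fin q) (Fin q) ℝ} (hσ : IsFrameMatrix Φ Y σ)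
    {φ : EuclideanSpace ℝ (Fin q)} (hφ : φ ∈ Φ)
    (ι : W →ₗᵢ[ℝ] V) (P : V) (hS : ∀ w ∈ S, P + ι w ∈ Γ) (hP : P + ι (Y φ) = X θ)
    {N : V} {N' : W} (hN' : ι N' = N) (hN : ∀ a, inner ℝ (fderiv ℝ X θ a) N = 0) :
    ∃ η : Matrix (Fin n) (Fin q) ℝ, η.transpose * η = 1 ∧
      curvatureMatrix Y σ N' φ = η.transpose * curvatureMatrix X τ N θ * η := by
  have hcmp := exists_fderiv_eq_and_second_eq hX hθ hY hφ ι P hS hP hN' hN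
  obtain ⟨l, hl⟩ := (fderiv ℝ X θ).toLinearMap.exists_leftInverse_of_injective
    (LinearMap.ker_eq_bot.mpr (hX.injective_fderiv hθ))
  -- The vector `a` is known only separately for each `b`; the left inverse `l` makes the choice
  -- linear, which polarization in `hpol` requires.
  set A : EuclideanSpace ℝ (Fin q) →ₗ[ℝ] EuclideanSpace ℝ (Fin n) :=
    l ∘ₗ ι.toLinearMap ∘ₗ (fderiv ℝ Y φ).toLinearMap with hA
  have hcmpA : ∀ b, fderiv ℝ X θ (A b) = ι (fderiv ℝ Y φ b) ∧
      (inner ℝ (fderiv ℝ (fderiv ℝ X) θ (A b) (A b)) N : ℝ) =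
        inner ℝ (fderiv ℝ (fderiv ℝ Y) φ b b) N' := by
    intro b
    obtain ⟨a, ha, ha2⟩ := hcmp b
    have : A b = a := by
      change l (ι (fderiv ℝ Y φ b)) = a
      rw [← ha]
      exact LinearMap.congr_fun hl a
    rw [this]
    exact ⟨ha, ha2⟩
  have hNY : ∀ b, inner ℝ (fderiv ℝ Y φ b) N' = 0 := fun b => by
    rw [← ι.inner_map_map, ← (hcmpA b).1, hN', hN]
  have hXsymm : IsSymmSndFDerivAt ℝ X θ := (hX.contDiffAt hθ).isSymmSndFDerivAt (by simp)
  have hYsymm : IsSymmSndFDerivAt ℝ Y φ := (hY.contDiffAt hφ).isSymmSndFDerivAt (by simp)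
  have hpol : ∀ u v, (inner ℝ (fderiv ℝ (fderiv ℝ X) θ (A u) (A v)) N : ℝ) =
      inner ℝ (fderiv ℝ (fderiv ℝ Y) φ u v) N' := by
    intro u v
    have h1 := (hcmpA (u + v)).2
    simp only [map_add, add_apply, inner_add_left, (hcmpA u).2, (hcmpA v).2,
      hXsymm (A v) (A u), hYsymm v u] at h1
    linarith
  -- Coordinates of the frame of `S` in the orthonormal frame of `Γ`.
  set η : Matrix (Fin n) (Fin q) ℝ := Matrix.of fun k i =>
    inner ℝ (fderiv ℝ X θ (frameVec τ k θ)) (fderiv ℝ X θ (A (frameVec σ i φ))) with hη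
  have hexp : ∀ i, A (frameVec σ i φ) = ∑ k, η k i • frameVec τ k θ := fun i =>
    (hτ.sum_inner_smul_frameVec hX hθ _).symm
  refine ⟨η, ?_, ?_⟩
  · ext i j
    rw [← hσ.inner_frameVec hY hφ, ← ι.inner_map_map, ← (hcmpA _).1, ← (hcmpA _).1,
      hexp i, map_sum, sum_inner, Matrix.mul_apply]
    refine Finset.sum_congr rfl fun k _ => ?_
    rw [map_smul, inner_smul_left]
    rfl
  · ext i j
    rw [curvatureMatrix_apply hY hσ hφ hNY, ← hpol, hexp i, hexp j]
    simp only [map_sum, map_smul, sum_apply, smul_apply,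
      sum_inner, inner_smul_left, conj_trivial, Matrix.mul_apply, Matrix.transpose_apply,
      curvatureMatrix_apply hX hτ hθ hN, Finset.sum_mul, Finset.mul_sum]
    rw [Finset.sum_comm]
    refine Finset.sum_congr rfl fun k _ => Finset.sum_congr rfl fun k' _ => ?_
    ring

end Comparison

end SurfaceGeometry

/-! ### Propagation of `m`-convexity and restriction to normal sections. -/

namespace SurfaceGeometry

open Topology Filter

section Hypersurface

variable {V : Type*} [NormedAddCommGroup V] [InnerProductSpace ℝ V] {n : ℕ}

theorem IsUnitNormalField.inner_fderiv {Γ : Set V} {ν : V → V} (hν : IsUnitNormalField n Γ ν)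
    {O : Set V} {Θ : Set (EuclideanSpace ℝ (Fin n))} {X : EuclideanSpace ℝ (Fin n) → V}
    (hX : IsLocalParam 2 Γ O Θ X) {θ : EuclideanSpace ℝ (Fin n)} (hθ : θ ∈ Θ)
    (a : EuclideanSpace ℝ (Fin n)) : inner ℝ (fderiv ℝ X θ a) (ν (X θ)) = 0 := by
  rw [fderiv_apply_eq_sum, sum_inner]
  exact Finset.sum_eq_zero fun j _ => by rw [inner_smul_left, hν.2.2 O Θ X hX θ hθ j, mul_zero]

theorem IsLocalParam.mapsTo {k : WithTop ℕ∞} {S O : Set V} {Θ : Set (EuclideanSpace ℝ (Fin n))}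
    {X : EuclideanSpace ℝ (Fin n) → V} (hX : IsLocalParam k S O Θ X)
    {θ : EuclideanSpace ℝ (Fin n)} (hθ : θ ∈ Θ) : X θ ∈ S ∩ O :=
  hX.image_eq ▸ Set.mem_image_of_mem X hθ

theorem continuousOn_curvatureMatrix {Γ : Set V} {ν : V → V} (hν : IsUnitNormalField n Γ ν)
    {O : Set V} {Θ : Set (EuclideanSpace ℝ (Fin n))} {X : EuclideanSpace ℝ (Fin n) → V}
    {τ : EuclideanSpace ℝ (Fin n) → Matrix (Fin n) (Fin n) ℝ}
    (hX : IsLocalParam 2 Γ O Θ X) (hτ : IsFrameMatrix Θ X τ) :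
    ContinuousOn (fun θ => curvatureMatrix X τ (ν (X θ)) θ) Θ := by
  refine continuousOn_pi.mpr fun i => continuousOn_pi.mpr fun j => ?_
  have h1 : ContDiffOn ℝ 1 (fderiv ℝ X) Θ :=
    hX.contDiffOn.fderiv_of_isOpen hX.isOpen_domain (by norm_num)
  have h2 : ContinuousOn (fderiv ℝ (fderiv ℝ X)) Θ :=
    h1.continuousOn_fderiv_of_isOpen hX.isOpen_domain (by norm_num)
  have h3 : ContinuousOn (fun θ => ν (X θ)) Θ :=
    hν.1.comp hX.contDiffOn.continuousOn fun θ hθ => (hX.mapsTo hθ).1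
  have h4 := fun j => (hτ.contDiffOn_frameVec j).continuousOn
  exact (((h2.clm_apply (h4 j)).clm_apply (h4 i)).inner h3).congr fun θ hθ =>
    curvatureMatrix_apply hX hτ hθ (fun a => hν.inner_fderiv hX hθ a) i j

theorem isSymm_curvatureMatrix {S O : Set V} {Θ : Set (EuclideanSpace ℝ (Fin n))}
    {X : EuclideanSpace ℝ (Fin n) → V} (hX : IsLocalParam 2 S O Θ X)
    {τ : EuclideanSpace ℝ (Fin n) → Matrix (Fin n) (Fin n) ℝ} (hτ : IsFrameMatrix Θ X τ)
    {θ : EuclideanSpace ℝ (Fin n)} (hθ : θ ∈ Θ) {N : V}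
    (hN : ∀ a, inner ℝ (fderiv ℝ X θ a) N = 0) : (curvatureMatrix X τ N θ).IsSymm := by
  have hsymm : IsSymmSndFDerivAt ℝ X θ := (hX.contDiffAt hθ).isSymmSndFDerivAt (by simp)
  refine Matrix.IsSymm.ext fun i j => ?_
  rw [curvatureMatrix_apply hX hτ hθ hN, curvatureMatrix_apply hX hτ hθ hN, hsymm]

variable [FiniteDimensional ℝ V]

/-- Curvature matrices at a point are unique up to orthogonal similarity. -/
theorem IsCurvatureMatrix.orthogonally_similar {Γ : Set V} {ν : V → V}
    (hν : IsUnitNormalField n Γ ν) {M : V} {K K' : Matrix (Fin n) (Fin n) ℝ}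
    (hK : IsCurvatureMatrix Γ M (ν M) K) (hK' : IsCurvatureMatrix Γ M (ν M) K') :
    ∃ U : Matrix (Fin n) (Fin n) ℝ, U.transpose * U = 1 ∧ K' = U.transpose * K * U := by
  obtain ⟨O, Θ, X, τ, θ, hX, hτ, hθ, rfl, rfl⟩ := hK
  obtain ⟨O', Φ, Y, σ, φ, hY, hσ, hφ, hYX, rfl⟩ := hK'
  -- `Γ` is compared with itself through the identity, so `η` is square and therefore orthogonal.
  exact exists_curvatureMatrix_eq hX hτ hθ hY hσ hφ LinearIsometry.id 0 (by simp)
    (by simpa using hYX) rfl fun a => hν.inner_fderiv hX hθ a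

/-- On an oriented hypersurface with `k_m > 0`, the existence of one point of `m`-convexity implies
that all points are points of `m`-convexity. -/
theorem isMConvexAt_of_forall_pos {Γ : Set V} (hΓ : IsPreconnected Γ) {ν : V → V}
    (hν : IsUnitNormalField n Γ ν) {m : ℕ} (hmn : m ≤ n)
    (hpos : ∀ M ∈ Γ, ∃ c : ℝ, HasPCurvature n m Γ M (ν M) c ∧ 0 < c) {M M' : V} (hM : M ∈ Γ)
    (hM' : M' ∈ Γ) (hconv : IsMConvexAt n m Γ M (ν M)) : IsMConvexAt n m Γ M' (ν M') := by
  have key : IsMConvexAt n m Γ M (ν M) ↔ IsMConvexAt n m Γ M' (ν M') := by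
    refine hΓ.induction₂ (fun x y => IsMConvexAt n m Γ x (ν x) ↔ IsMConvexAt n m Γ y (ν y))
      ?_ ?_ ?_ hM hM'
    · intro P hP
      -- The existence of the `m`-curvature at `P` already provides a parametrization with a `C^1`
      -- frame on a connected domain.
      obtain ⟨-, ⟨-, ⟨O, Θ, X, τ, θ, hX, hτ, hθ, rfl, -⟩, -⟩, -⟩ := hpos P hP
      set K : EuclideanSpace ℝ (Fin n) → Matrix (Fin n) (Fin n) ℝ :=
        fun θ => curvatureMatrix X τ (ν (X θ)) θ with hKdef
      have hcurv : ∀ x ∈ Θ, IsCurvatureMatrix Γ (X x) (ν (X x)) (K x) := fun x hx =>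
        ⟨O, Θ, X, τ, x, hX, hτ, hx, rfl, rfl⟩
      have hiff : ∀ x ∈ Θ, IsMConvexAt n m Γ (X x) (ν (X x)) ↔ IsMPositive m (K x) := by
        intro x hx
        refine ⟨?_, fun h => ⟨K x, hcurv x hx, h⟩⟩
        rintro ⟨K', hK', hpos'⟩
        obtain ⟨U, hU, hKU⟩ := hK'.orthogonally_similar hν (hcurv x hx)
        rw [hKU]
        exact hpos'.transpose_mul_mul hU
      have hKpos : ∀ x ∈ Θ, 0 < pTrace m (K x) := by
        intro x hx
        obtain ⟨c, ⟨K', hK', rfl⟩, hc⟩ := hpos (X x) (hX.mapsTo hx).1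
        obtain ⟨U, hU, hKU⟩ := hK'.orthogonally_similar hν (hcurv x hx)
        rwa [hKU, pTrace_transpose_mul_mul hU]
      have hKsymm : ∀ x ∈ Θ, (K x).IsSymm := fun x hx =>
        isSymm_curvatureMatrix hX hτ hx fun a => hν.inner_fderiv hX hx a
      have hprop : ∀ x ∈ Θ, ∀ y ∈ Θ, IsMPositive m (K x) → IsMPositive m (K y) :=
        fun x hx y hy => isMPositive_of_isPreconnected hX.isConnected_domain.isPreconnected hmn
          (continuousOn_curvatureMatrix hν hX hτ) hKsymm hKpos hx hy
      filter_upwards [self_mem_nhdsWithin,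
        nhdsWithin_le_nhds (hX.isOpen_target.mem_nhds (hX.mapsTo hθ).2)] with Q hQ hQO
      obtain ⟨y, hy, rfl⟩ : Q ∈ X '' Θ := hX.image_eq ▸ ⟨hQ, hQO⟩
      rw [hiff θ hθ, hiff y hy]
      exact ⟨hprop θ hθ y hy, hprop y hy θ hθ⟩
    · intro _ _ _ _ _ _ h1 h2; exact h1.trans h2
    · intro _ _ _ _ h; exact h.symm
  exact key.mp hconv

/-- The `(m-p)`-curvatures of normal `(n-p)`-sections are positive at points of `m`-convexity. -/
theorem IsMConvexAt.pTrace_normalSection_pos {Γ : Set V} {ν : V → V}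
    (hν : IsUnitNormalField n Γ ν) {m p q : ℕ} (hq : n = q + p) (hmn : m ≤ n) (hpm : p ≤ m) {M : V}
    (hconv : IsMConvexAt n m Γ M (ν M)) {L : Submodule ℝ V}
    {K : Matrix (Fin q) (Fin q) ℝ}
    (hK : IsCurvatureMatrix (normalSection Γ M (ν M) L) 0 (sectionNormal (ν M) L) K) :
    0 < pTrace (m - p) K := by
  subst hq
  obtain ⟨r, rfl⟩ : ∃ r, m = r + p := ⟨m - p, by omega⟩
  obtain ⟨-, ⟨O, Θ, X, τ, θ, hX, hτ, hθ, rfl, rfl⟩, hpos⟩ := hconv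
  obtain ⟨O', Φ, Y, σ, φ, hY, hσ, hφ, hY0, rfl⟩ := hK
  obtain ⟨η, hη, hKη⟩ := exists_curvatureMatrix_eq hX hτ hθ hY hσ hφ
    (sectionalPlane (ν (X θ)) L).subtypeₗᵢ (X θ) (fun w hw => hw) (by simp [hY0])
    (N' := sectionNormal (ν (X θ)) L) rfl fun a => hν.inner_fderiv hX hθ a
  rw [hKη, Nat.add_sub_cancel]
  exact (hpos.compression (by omega) hη).2 r le_rfl

end Hypersurface

end SurfaceGeometry

theorem corollary5p16 (n m p : ℕ) (k : ℕ∞) (hk : 2 ≤ k) (hmn : m ≤ n) (hp : 1 ≤ p)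
    (hpm : p ≤ m - 1)
    (Γ : Set (EuclideanSpace ℝ (Fin (n + 1))))
    (ν : EuclideanSpace ℝ (Fin (n + 1)) → EuclideanSpace ℝ (Fin (n + 1)))
    (hΓ : IsSmoothSurface n k Γ) (hν : IsUnitNormalField n Γ ν)
    (hpos : ∀ M ∈ Γ, ∃ c : ℝ, HasPCurvature n m Γ M (ν M) c ∧ 0 < c)
    (M₀ : EuclideanSpace ℝ (Fin (n + 1))) (hM₀ : M₀ ∈ Γ)
    (L : Submodule ℝ (EuclideanSpace ℝ (Fin (n + 1)))) (hL : IsDirection n (n - p) Γ M₀ L)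
    (hzero : HasPCurvature (n - p) (m - p) (normalSection Γ M₀ (ν M₀) L) 0
      (sectionNormal (ν M₀) L) 0) :
    ∀ M ∈ Γ, ¬ IsMConvexAt n m Γ M (ν M) := by
  intro M hM hconv
  obtain ⟨K, hK, hK0⟩ := hzero
  have h0 := isMConvexAt_of_forall_pos hΓ.1.isPreconnected hν hmn hpos hM hM₀ hconv
  exact (h0.pTrace_normalSection_pos hν (by omega) hmn (by omega) hK).ne' hK0
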